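/- **Theorem 5.10.** Let $L$ be a finitary one-sorted signature and let $(\mathcal K,\prec_{\mathcal K})$ be an abstract elementary class of $L$-structures with the joint embedding property and the amalgamation property; let $\mathrm{LS}(\mathcal K)$ be its Löwenheim–Skolem number. For $M\in\mathcal K$ let $\text{ga-S}(M)$ denote the set of Galois types (of single elements) over $M$. For a cardinal $\nu$, $\mathcal K$ is called *$\nu$-stable* if $|\text{ga-S}(M)|=\nu$ for every $M\in\mathcal K$ with $|M|=\nu$, and *$\nu$-tame* if for every $M\in\mathcal K$ and all distinct $p,p'\in\text{ga-S}(M)$ there is $N\prec_{\mathcal K}M$ with $|N|\le\nu$ and $p\upharpoonright N\ne p'\upharpoonright N$. Suppose that $\mathcal K$ is $\chi$-tame for some $\chi\ge\mathrm{LS}(\mathcal K)$, and $\lambda$-stable for some $\lambda\ge\chi$ with $\lambda^{\aleph_0}>\lambda$. Let $\mu$ be a cardinal with $\mathrm{cf}(\mu)>\lambda$, let $\kappa<\mu$, and suppose that there is a set $S$ of cardinals, cofinal in the interval $[\kappa,\mu)$ of cardinals (that is, $S\subseteq[\kappa,\mu)$ and every $\nu\in[\kappa,\mu)$ satisfies $\nu\le\sigma$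 for some $\sigma\in S$), such that $\mathcal K$ is $\sigma$-stable for every $\sigma\in S$. Then $\mathcal K$ is $\mu$-stable. -/

import Mathlib

open FirstOrder Cardinal

universe u v w

/-- An abstract elementary class of `L`-structures, `L` a finitary one-sorted signature.
`Mem M` says that the `L`-structure `M` belongs to the class `𝒦`. Since `M₀ ≺ M` implies that `M₀` is
a substructure of `M`, the strong submodel relation is recorded on substructures: `Strong S` says
that the structure with underlying set `S` satisfies `S ≺ M`, where `M` is the ambient structure
of `S`. For substructures `S ≤ T` of `U`, "`S ≺ T`" is thus `Strong (S.comap T.subtype.toHom)`, as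
`S.comap T.subtype.toHom` is `S` regarded as a substructure of the structure `T`. -/
structure AbstractElementaryClass (L : FirstOrder.Language.{u, v}) where
  /-- membership in the class -/
  Mem : ∀ (M : Type w) [L.Structure M], Prop
  /-- the strong submodel relation, `S ≺ M` -/
  Strong : ∀ {M : Type w} [L.Structure M], L.Substructure M → Prop
  /-- `≺` is a relation between members of the class -/
  mem_left : ∀ {M : Type w} [L.Structure M] {S : L.Substructure M}, Strong S → Mem S
  mem_right : ∀ {M : Type w} [L.Structure M] {S : L.Substructure M}, Strong S → Mem M
  /-- closure under isomorphism, of the class and of the relation -/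
  mem_iso : ∀ {M N : Type w} [L.Structure M] [L.Structure N], (M ≃[L] N) → Mem M → Mem N
  strong_iso : ∀ {M N : Type w} [L.Structure M] [L.Structure N] (e : M ≃[L] N)
    {S : L.Substructure M}, Strong S → Strong (S.map e.toHom)
  /-- `≺` is reflexive and transitive (it is antisymmetric because `⊆` is) -/
  strong_refl : ∀ {M : Type w} [L.Structure M], Mem M → Strong (⊤ : L.Substructure M)
  strong_trans : ∀ {M : Type w} [L.Structure M] {T : L.Substructure M} {S : L.Substructure T},
    Strong S → Strong T → Strong (S.map T.subtype.toHom)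
  /-- Unions of chains, (1) and (2): if the `L`-structure `U` is the union of a continuous
  `≺`-increasing sequence `(M α | α < δ)`, then `U` is in the class and `M α ≺ U` for all `α`. -/
  chain_union : ∀ {U : Type w} [L.Structure U] (δ : Ordinal.{w}) (_ : 0 < δ)
    (M : Ordinal.{w} → L.Substructure U),
    (∀ α β, α ≤ β → β < δ →
      M α ≤ M β ∧ Strong ((M α).comap (M β).subtype.toHom)) →
    (∀ γ, γ < δ → Order.IsSuccLimit γ → (M γ : Set U) = ⋃ β ∈ Set.Iio γ, (M β : Set U)) →
    (⋃ α ∈ Set.Iio δ, (M α : Set U)) = Set.univ →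
    Mem U ∧ ∀ α, α < δ → Strong (M α)
  /-- Unions of chains, (3): if moreover all `M α ≺ N`, then the union is `≺ N`. -/
  chain_union_strong : ∀ {N : Type w} [L.Structure N] (δ : Ordinal.{w}) (_ : 0 < δ)
    (M : Ordinal.{w} → L.Substructure N),
    (∀ α β, α ≤ β → β < δ →
      M α ≤ M β ∧ Strong ((M α).comap (M β).subtype.toHom)) →
    (∀ γ, γ < δ → Order.IsSuccLimit γ → (M γ : Set N) = ⋃ β ∈ Set.Iio γ, (M β : Set N)) →
    (∀ α, α < δ → Strong (M α)) →
    ∀ V : L.Substructure N, (V : Set N) = ⋃ α ∈ Set.Iio δ, (M α : Set N) → Strong V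
  /-- Coherence -/
  coherence : ∀ {M : Type w} [L.Structure M] {S T : L.Substructure M},
    Strong S → Strong T → S ≤ T → Strong (S.comap T.subtype.toHom)
  /-- Downward Löwenheim–Skolem -/
  exists_LS : ∃ κ : Cardinal.{w}, ℵ₀ ≤ κ ∧
    ∀ {M : Type w} [L.Structure M], Mem M → ∀ A : Set M,
      ∃ S : L.Substructure M, A ⊆ S ∧ Strong S ∧ #S ≤ #A + κ

namespace AbstractElementaryClass

variable {L : FirstOrder.Language.{u, v}} (K : AbstractElementaryClass.{u, v, w} L)

/-- The Löwenheim–Skolem number: the least infinite cardinal with the downward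
Löwenheim–Skolem property. -/
noncomputable def LS : Cardinal.{w} :=
  sInf {κ : Cardinal.{w} | ℵ₀ ≤ κ ∧
    ∀ {M : Type w} [L.Structure M], K.Mem M → ∀ A : Set M,
      ∃ S : L.Substructure M, A ⊆ S ∧ K.Strong S ∧ #S ≤ #A + κ}

section Basic

variable {M N P : Type w} [L.Structure M] [L.Structure N] [L.Structure P]

/-- `f` is a `𝒦`-embedding (strong embedding): an isomorphism onto a strong submodel. -/
def IsStrong (f : M ↪[L] N) : Prop := K.Strong f.toHom.range

theorem IsStrong.comp {K : AbstractElementaryClass.{u, v, w} L} {g : N ↪[L] P} {f : M ↪[L] N}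
    (hg : K.IsStrong g) (hf : K.IsStrong f) : K.IsStrong (g.comp f) := by
  have h := K.strong_trans (K.strong_iso g.equivRange hf) hg
  have e : (f.toHom.range.map g.equivRange.toHom).map g.toHom.range.subtype.toHom
      = (g.comp f).toHom.range := by
    ext x
    simp
  rw [e] at h
  exact h

theorem isStrong_subtype {S : L.Substructure M} (hS : K.Strong S) : K.IsStrong S.subtype := by
  unfold IsStrong
  rwa [FirstOrder.Language.Substructure.range_subtype]

end Basic

/-- The joint embedding property. -/
def JEP : Prop :=
  ∀ (M₁ M₂ : Type w) [L.Structure M₁] [L.Structure M₂], K.Mem M₁ → K.Mem M₂ →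
    ∃ (N : Type w) (_ : L.Structure N) (f₁ : M₁ ↪[L] N) (f₂ : M₂ ↪[L] N),
      K.IsStrong f₁ ∧ K.IsStrong f₂

/-- The amalgamation property. -/
def AP : Prop :=
  ∀ (M₀ M₁ M₂ : Type w) [L.Structure M₀] [L.Structure M₁] [L.Structure M₂]
    (f₁ : M₀ ↪[L] M₁) (f₂ : M₀ ↪[L] M₂), K.IsStrong f₁ → K.IsStrong f₂ →
    ∃ (N : Type w) (_ : L.Structure N) (g₁ : M₁ ↪[L] N) (g₂ : M₂ ↪[L] N),
      K.IsStrong g₁ ∧ K.IsStrong g₂ ∧ g₁.comp f₁ = g₂.comp f₂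

section Types

variable (M : Type w) [L.Structure M]

/-- A strong extension of `M` together with an element of it. -/
structure PointedExt where
  /-- the extension -/
  carrier : Type w
  [str : L.Structure carrier]
  /-- the strong embedding of `M` -/
  emb : M ↪[L] carrier
  strong : K.IsStrong emb
  /-- the element -/
  pt : carrier

attribute [instance] PointedExt.str

variable {M} in
/-- Two pointed extensions of `M` are related if they can be strongly embedded over `M` into a
common member of the class so that the two elements are identified. -/
def PointedExt.Rel (x y : K.PointedExt M) : Prop :=
  ∃ (N : Type w) (_ : L.Structure N) (g : x.carrier ↪[L] N) (h : y.carrier ↪[L] N),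
    K.IsStrong g ∧ K.IsStrong h ∧ g.comp x.emb = h.comp y.emb ∧ g x.pt = h y.pt

/-- `ga-S(M)`, the Galois types over `M`: pointed strong extensions of `M` modulo the equivalence
relation generated by `Rel`. Under amalgamation `Rel` is itself an equivalence relation, and the
type of `a ∈ 𝔠` over `M ≺ 𝔠` is the orbit of `a` under the automorphisms over `M` of a (strongly
model-homogeneous) monster model `𝔠`. -/
def GaS : Type (max u v (w + 1)) := Quot (PointedExt.Rel K (M := M))

variable {M} {N : Type w} [L.Structure N]

/-- A pointed extension of `M`, regarded as one of `N` along `f : N ↪ M`. -/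
def PointedExt.pull (f : N ↪[L] M) (hf : K.IsStrong f) (x : K.PointedExt M) :
    K.PointedExt N where
  carrier := x.carrier
  emb := x.emb.comp f
  strong := x.strong.comp hf
  pt := x.pt

/-- Restriction of Galois types along a strong embedding. -/
def GaS.restrict (f : N ↪[L] M) (hf : K.IsStrong f) : K.GaS M → K.GaS N :=
  Quot.map (PointedExt.pull K f hf) (by
    rintro x y ⟨P, sP, g, h, hg, hh, e, ept⟩
    refine ⟨P, sP, g, h, hg, hh, ?_, ept⟩
    ext n
    exact DFunLike.congr_fun e (f n))

end Types

/-- `K` is `lam`-(Galois-)stable: over every model of cardinality `lam` there are exactly `lam`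
Galois types. -/
def Stable (lam : Cardinal.{w}) : Prop :=
  ∀ (M : Type w) [L.Structure M], K.Mem M → #M = lam →
    #(K.GaS M) = Cardinal.lift.{max u v (w + 1), w} lam

/-- `K` is `χ`-tame: distinct Galois types over a model `M` have distinct restrictions to some
strong submodel of `M` of cardinality at most `χ`. -/
def Tame (χ : Cardinal.{w}) : Prop :=
  ∀ (M : Type w) [L.Structure M], K.Mem M → ∀ p q : K.GaS M, p ≠ q →
    ∃ (S : L.Substructure M) (hS : K.Strong S), #S ≤ χ ∧
      GaS.restrict K S.subtype (K.isStrong_subtype hS) p ≠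
        GaS.restrict K S.subtype (K.isStrong_subtype hS) q

end AbstractElementaryClass

/-! Suppose that `M` has size `μ` but more than `μ` types. Since initial segments of `M` in order
type `μ` lie in strong submodels whose sizes are in `S`, there is a family of `μ` strong submodels,
each with at most `μ` types, that captures every submodel of size at most `lam < cf μ`. Discard each
type whose restriction to some member of the family is shared by at most `μ` types. Only `μ` types
are lost, and each survivor still has more than `μ` surviving companions over every strong submodel
of size at most `lam` (`exists_splitting_set`).

Survivors therefore split `lam` times at every step of an `ω`-construction. By tameness, `lam`
distinct types are already distinct over a submodel of size `lam`, so the whole tree lives on a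
union `N` of size `lam`. Amalgamation and a direct limit give every branch a type over `N`
(`GaS.exists_restrict_eq_of_seq`). Distinct branches give distinct types, so `N` has at least `lam ^
ℵ₀ > lam` types, contradicting `lam`-stability. -/

namespace AbstractElementaryClass

open FirstOrder.Language

variable {L : FirstOrder.Language.{u, v}} {K : AbstractElementaryClass.{u, v, w} L}

/-! ### Strong embeddings -/

section Strong

variable {M N P : Type w} [L.Structure M] [L.Structure N] [L.Structure P]

theorem IsStrong.mem {f : M ↪[L] N} (hf : K.IsStrong f) : K.Mem N :=
  K.mem_right hf

theorem isStrong_refl (hM : K.Mem M) : K.IsStrong (Embedding.refl L M) := by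
  have h := K.strong_refl hM
  have e : (Embedding.refl L M).toHom.range = ⊤ := by
    ext x
    simp
  unfold IsStrong
  rwa [e]

theorem isStrong_inclusion {S T : L.Substructure M} (hS : K.Strong S) (hT : K.Strong T)
    (h : S ≤ T) : K.IsStrong (Substructure.inclusion h) := by
  have h' := K.coherence hS hT h
  have e : (Substructure.inclusion h).toHom.range = S.comap T.subtype.toHom := by
    ext ⟨x, hx⟩
    simp [Substructure.inclusion, Subtype.ext_iff]
  unfold IsStrong
  rwa [e]

/-- Supplies the chain axiom in a direct limit, where one stage must be strong in the next before
either is known to be strong in the limit. -/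
theorem strong_comap_range {f : M ↪[L] N} (hf : K.IsStrong f) (g : N ↪[L] P) :
    K.Strong ((g.comp f).toHom.range.comap g.toHom.range.subtype.toHom) := by
  have h := K.strong_iso g.equivRange hf
  have e : (g.comp f).toHom.range.comap g.toHom.range.subtype.toHom =
      f.toHom.range.map g.equivRange.toHom := by
    ext ⟨x, hx⟩
    simp [Subtype.ext_iff]
  rwa [e]

theorem natLERec_succ {C : ℕ → Type w} [∀ n, L.Structure (C n)] (g : ∀ n, C n ↪[L] C (n + 1))
    (n : ℕ) : DirectedSystem.natLERec g n (n + 1) n.le_succ = g n := by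
  ext x
  simp [Nat.leRecOn_succ']

theorem isStrong_natLERec {C : ℕ → Type w} [∀ n, L.Structure (C n)]
    (hC : ∀ n, K.Mem (C n)) (g : ∀ n, C n ↪[L] C (n + 1)) (hg : ∀ n, K.IsStrong (g n))
    (m n : ℕ) (h : m ≤ n) : K.IsStrong (DirectedSystem.natLERec g m n h) := by
  induction n, h using Nat.le_induction with
  | base =>
    have e : DirectedSystem.natLERec g m m le_rfl = Embedding.refl L _ := by
      ext x
      simp [Nat.leRecOn_self]
    rw [e]
    exact isStrong_refl (hC m)
  | succ n h ih =>
    have e : DirectedSystem.natLERec g m (n + 1) (h.trans (Nat.le_succ n)) =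
        (g n).comp (DirectedSystem.natLERec g m n h) := by
      ext x
      simp [Nat.leRecOn_succ h]
    rw [e]
    exact (hg n).comp ih

end Strong

/-! ### Chains of length `ω` and direct limits -/

section Chains

variable {M : Type w} [L.Structure M]

/-- The chain axioms index by ordinals; an `ω`-sequence enters them through `a ↦ Cardinal.toNat
a.card`, whose values from `ω` on are never consulted. -/
theorem lt_omega0_mono {α β : Ordinal.{w}} (h : α ≤ β) (hβ : β < Ordinal.omega0) :
    Cardinal.toNat α.card ≤ Cardinal.toNat β.card := by
  obtain ⟨n, rfl⟩ := Ordinal.lt_omega0.1 hβ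
  obtain ⟨m, rfl⟩ := Ordinal.lt_omega0.1 (h.trans_lt hβ)
  simpa using h

theorem iUnion_lt_omega0 {α : Type*} (T : ℕ → Set α) :
    (⋃ a ∈ Set.Iio (Ordinal.omega0.{w}), T (Cardinal.toNat a.card)) = ⋃ n, T n := by
  ext x
  simp only [Set.mem_iUnion, Set.mem_Iio]
  constructor
  · rintro ⟨a, -, hx⟩
    exact ⟨_, hx⟩
  · rintro ⟨n, hx⟩
    exact ⟨n, Ordinal.natCast_lt_omega0 n, by simpa using hx⟩

theorem not_isSuccLimit_of_lt_omega0 {γ : Ordinal.{w}} (h : γ < Ordinal.omega0) :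
    ¬ Order.IsSuccLimit γ := fun hl => (Ordinal.omega0_le_of_isSuccLimit hl).not_gt h

/-- Unions of increasing sequences of length `ω` belong to the class. -/
theorem strong_of_iUnion_eq_univ (T : ℕ →o L.Substructure M)
    (hT : ∀ m n, m ≤ n → K.Strong ((T m).comap (T n).subtype.toHom))
    (hu : (⋃ n, (T n : Set M)) = Set.univ) (n : ℕ) : K.Strong (T n) := by
  have h := (K.chain_union (U := M) Ordinal.omega0 Ordinal.omega0_pos
    (fun a => T (Cardinal.toNat a.card))
    (fun a b hab hb => ⟨T.monotone (lt_omega0_mono hab hb), hT _ _ (lt_omega0_mono hab hb)⟩)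
    (fun γ hγ hl => (not_isSuccLimit_of_lt_omega0 hγ hl).elim)
    ((iUnion_lt_omega0 fun n => (T n : Set M)).trans hu)).2 n (Ordinal.natCast_lt_omega0 n)
  simpa using h

theorem coe_iSup_orderHom (T : ℕ →o L.Substructure M) :
    ((⨆ n, T n : L.Substructure M) : Set M) = ⋃ n, (T n : Set M) := by
  ext x
  simp [Substructure.mem_iSup_of_directed T.monotone.directed_le]

/-- The union of an increasing sequence of strong submodels is a strong submodel. -/
theorem strong_iSup (T : ℕ →o L.Substructure M) (hT : ∀ n, K.Strong (T n)) :
    K.Strong (⨆ n, T n) := by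
  refine K.chain_union_strong Ordinal.omega0 Ordinal.omega0_pos
    (fun a => T (Cardinal.toNat a.card))
    (fun a b hab hb => ?_) (fun γ hγ hl => (not_isSuccLimit_of_lt_omega0 hγ hl).elim)
    (fun a _ => hT _) _ ?_
  · have h := T.monotone (lt_omega0_mono hab hb)
    exact ⟨h, K.coherence (hT _) (hT _) h⟩
  · rw [iUnion_lt_omega0 fun n => (T n : Set M)]
    exact coe_iSup_orderHom T

/-- Strong embeddings into the direct limit of a sequence of strong embeddings. -/
theorem isStrong_directLimit_of {C : ℕ → Type w} [∀ n, L.Structure (C n)]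
    (hC : ∀ n, K.Mem (C n)) (g : ∀ n, C n ↪[L] C (n + 1)) (hg : ∀ n, K.IsStrong (g n)) (n : ℕ) :
    K.IsStrong (DirectLimit.of L ℕ C (DirectedSystem.natLERec g) n) := by
  have hcomp : ∀ m n (h : m ≤ n), (DirectLimit.of L ℕ C (DirectedSystem.natLERec g) n).comp
      (DirectedSystem.natLERec g m n h) =
      DirectLimit.of L ℕ C (DirectedSystem.natLERec g) m := fun m n h => by
    ext x
    exact DirectLimit.of_f
  let T : ℕ →o L.Substructure (Language.DirectLimit C (DirectedSystem.natLERec g)) :=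
    ⟨fun n => (DirectLimit.of L ℕ C (DirectedSystem.natLERec g) n).toHom.range, fun m n h => by
      rintro _ ⟨x, rfl⟩
      exact ⟨DirectedSystem.natLERec g m n h x, DirectLimit.of_f⟩⟩
  refine strong_of_iUnion_eq_univ T (fun m n h => ?_) ?_ n
  · have := strong_comap_range (isStrong_natLERec hC g hg m n h)
      (DirectLimit.of L ℕ C (DirectedSystem.natLERec g) n)
    rwa [hcomp] at this
  · refine Set.eq_univ_of_forall fun z => ?_
    obtain ⟨i, x, rfl⟩ := DirectLimit.exists_of z
    exact Set.mem_iUnion.2 ⟨i, x, rfl⟩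

end Chains

/-! ### Galois types under amalgamation -/

section Types

variable {M N P : Type w} [L.Structure M] [L.Structure N] [L.Structure P]

theorem PointedExt.rel_refl (x : K.PointedExt M) : PointedExt.Rel K x x :=
  ⟨x.carrier, x.str, Embedding.refl L _, Embedding.refl L _, isStrong_refl x.strong.mem,
    isStrong_refl x.strong.mem, rfl, rfl⟩

theorem PointedExt.rel_symm {x y : K.PointedExt M} :
    PointedExt.Rel K x y → PointedExt.Rel K y x := by
  rintro ⟨N, sN, g, h, hg, hh, e, ept⟩
  exact ⟨N, sN, h, g, hh, hg, e.symm, ept.symm⟩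

theorem PointedExt.rel_trans (hAP : K.AP) {x y z : K.PointedExt M} :
    PointedExt.Rel K x y → PointedExt.Rel K y z → PointedExt.Rel K x z := by
  rintro ⟨N, sN, g, h, hg, hh, e, ept⟩ ⟨N', sN', g', h', hg', hh', e', ept'⟩
  -- Amalgamate the two witnesses over the middle extension `y`.
  obtain ⟨P, sP, k, k', hk, hk', ek⟩ := hAP _ _ _ h g' hh hg'
  refine ⟨P, sP, k.comp g, k'.comp h', hk.comp hg, hk'.comp hh', ?_, ?_⟩
  · rw [Embedding.comp_assoc, e, ← Embedding.comp_assoc, ek, Embedding.comp_assoc, e',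
      Embedding.comp_assoc]
  · have := DFunLike.congr_fun ek y.pt
    simp only [Embedding.comp_apply] at this ⊢
    rw [ept, this, ept']

/-- Under amalgamation, equality of Galois types is witnessed by a single amalgam. -/
theorem GaS.mk_eq_mk (hAP : K.AP) {x y : K.PointedExt M} :
    (Quot.mk _ x : K.GaS M) = Quot.mk _ y ↔ PointedExt.Rel K x y :=
  Equivalence.quot_mk_eq_iff
    ⟨PointedExt.rel_refl, PointedExt.rel_symm, PointedExt.rel_trans hAP⟩ x y

theorem GaS.restrict_restrict (f : N ↪[L] M) (hf : K.IsStrong f) (g : P ↪[L] N)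
    (hg : K.IsStrong g) (p : K.GaS M) :
    GaS.restrict K g hg (GaS.restrict K f hf p) =
      GaS.restrict K (f.comp g) (hf.comp hg) p := by
  induction p using Quot.ind
  rfl

/-- The type realized by an element of the model. -/
def GaS.ofElem (hM : K.Mem M) (a : M) : K.GaS M :=
  Quot.mk _ ⟨M, Embedding.refl L M, isStrong_refl hM, a⟩

theorem GaS.ofElem_injective (hAP : K.AP) (hM : K.Mem M) :
    Function.Injective (GaS.ofElem hM) := by
  intro a b h
  obtain ⟨N, sN, g, h, -, -, e, ept⟩ := (GaS.mk_eq_mk hAP).1 h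
  have := DFunLike.congr_fun e a
  exact h.injective (this.symm.trans ept)

end Types

/-! ### Limits of `ω`-sequences of types -/

section Compactness

variable {M : Type w} [L.Structure M]

/-- One step of a coherent sequence of realizations. -/
theorem GaS.exists_realization_step (hAP : K.AP) {N : Type w} [L.Structure N] (f : N ↪[L] M)
    (hf : K.IsStrong f) (x : K.PointedExt N) (p : K.GaS M)
    (h : GaS.restrict K f hf p = Quot.mk _ x) :
    ∃ y : K.PointedExt M, Quot.mk _ y = p ∧ ∃ g : x.carrier ↪[L] y.carrier,
      K.IsStrong g ∧ g.comp x.emb = y.emb.comp f ∧ g x.pt = y.pt := by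
  induction p using Quot.ind with
  | mk z =>
  obtain ⟨P, sP, k, k', hk, hk', e, ept⟩ := (GaS.mk_eq_mk hAP).1 h.symm
  refine ⟨⟨P, k'.comp z.emb, hk'.comp z.strong, k' z.pt⟩, (GaS.mk_eq_mk hAP).2 ?_, k, hk, e, ept⟩
  exact ⟨P, sP, Embedding.refl L _, k', isStrong_refl hk.mem, hk', rfl, rfl⟩

/-- An increasing `ω`-sequence of Galois types has an upper bound over the union of the models. -/
theorem GaS.exists_restrict_eq_of_seq (hAP : K.AP) (T : ℕ →o L.Substructure M)
    (hT : ∀ n, K.Strong (T n)) (r : ∀ n, K.GaS (T n))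
    (hr : ∀ n, GaS.restrict K (Substructure.inclusion (T.monotone n.le_succ))
      (isStrong_inclusion (hT n) (hT (n + 1)) _) (r (n + 1)) = r n) :
    ∃ t : K.GaS (⨆ n, T n : L.Substructure M), ∀ n,
      GaS.restrict K (Substructure.inclusion (le_iSup T n))
        (isStrong_inclusion (hT n) (strong_iSup T hT) _) t = r n := by
  -- Representatives are chosen recursively, so that consecutive ones are linked by actual
  -- embeddings carrying point to point.
  let X : ℕ → Type _ := fun n => {x : K.PointedExt (T n) // Quot.mk _ x = r n}
  have step : ∀ n (x : X n), ∃ y : X (n + 1), ∃ g : x.1.carrier ↪[L] y.1.carrier,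
      K.IsStrong g ∧
      g.comp x.1.emb = y.1.emb.comp (Substructure.inclusion (T.monotone n.le_succ)) ∧
      g x.1.pt = y.1.pt := by
    intro n x
    obtain ⟨y, hy, g, hg⟩ := GaS.exists_realization_step hAP _ _ x.1 (r (n + 1))
      ((hr n).trans x.2.symm)
    exact ⟨⟨y, hy⟩, g, hg⟩
  choose next g hg hemb hpt using step
  obtain ⟨x₀, hx₀⟩ := Quot.exists_rep (r 0)
  let x : ∀ n, X n := fun n => Nat.rec ⟨x₀, hx₀⟩ next n
  let C : ℕ → Type w := fun n => (x n).1.carrier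
  let gs : ∀ n, C n ↪[L] C (n + 1) := fun n => g n (x n)
  have hgs : ∀ n, K.IsStrong (gs n) := fun n => hg n (x n)
  have hC : ∀ n, K.Mem (C n) := fun n => (x n).1.strong.mem
  let j : ∀ n, C n ↪[L] Language.DirectLimit C (DirectedSystem.natLERec gs) :=
    DirectLimit.of L ℕ C (DirectedSystem.natLERec gs)
  have hj : ∀ n, K.IsStrong (j n) := isStrong_directLimit_of hC gs hgs
  have jsucc : ∀ n a, j (n + 1) (gs n a) = j n a := by
    intro n a
    have h := DirectLimit.of_f (L := L) (f := DirectedSystem.natLERec gs)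
      (hij := n.le_succ) (x := a)
    rw [← h, natLERec_succ]
  have jpt : ∀ n, j n (x n).1.pt = j 0 (x 0).1.pt := by
    intro n
    induction n with
    | zero => rfl
    | succ n ih => exact (congrArg (j (n + 1)) (hpt n (x n))).symm.trans ((jsucc n _).trans ih)
  have jemb : ∀ m n (h : m ≤ n) (a : T m),
      j n ((x n).1.emb (Substructure.inclusion (T.monotone h) a)) = j m ((x m).1.emb a) := by
    intro m n h a
    induction n, h using Nat.le_induction with
    | base => rfl
    | succ n h ih =>
      rw [← ih, ← jsucc n]
      exact congrArg (j (n + 1)) (DFunLike.congr_fun (hemb n (x n))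
        (Substructure.inclusion (T.monotone h) a)).symm
  let e : (⨆ n, T n : L.Substructure M) ↪[L] Language.DirectLimit C (DirectedSystem.natLERec gs) :=
    (Language.DirectLimit.lift L ℕ _ _ (fun n => (j n).comp (x n).1.emb)
      (fun m n h a => jemb m n h a)).comp (DirectLimit.Equiv_iSup T).symm.toEmbedding
  have he : ∀ n, e.comp (Substructure.inclusion (le_iSup T n)) = (j n).comp (x n).1.emb := by
    intro n
    ext a
    have h := DirectLimit.Equiv_isup_symm_inclusion_apply T a
    exact (congrArg (Language.DirectLimit.lift L ℕ _ _ (fun n => (j n).comp (x n).1.emb)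
      (fun m n h a => jemb m n h a)) h).trans (Language.DirectLimit.lift_of ..)
  have hstrong : K.IsStrong e := by
    let R : ℕ →o L.Substructure (Language.DirectLimit C (DirectedSystem.natLERec gs)) :=
      ⟨fun n => ((j n).comp (x n).1.emb).toHom.range, fun m n h => by
        rintro _ ⟨a, rfl⟩
        exact ⟨Substructure.inclusion (T.monotone h) a, jemb m n h a⟩⟩
    have h := strong_iSup (K := K) R fun n => (hj n).comp (x n).1.strong
    have hR : e.toHom.range = ⨆ n, R n := by
      refine SetLike.coe_injective ?_
      rw [coe_iSup_orderHom R]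
      ext z
      simp only [Set.mem_iUnion]
      constructor
      · rintro ⟨⟨a, ha⟩, rfl⟩
        have ha' : a ∈ ((⨆ n, T n : L.Substructure M) : Set M) := ha
        rw [coe_iSup_orderHom T, Set.mem_iUnion] at ha'
        obtain ⟨n, hn⟩ := ha'
        exact ⟨n, ⟨a, hn⟩, (DFunLike.congr_fun (he n) ⟨a, hn⟩).symm⟩
      · rintro ⟨n, a, rfl⟩
        exact ⟨Substructure.inclusion (le_iSup T n) a, DFunLike.congr_fun (he n) a⟩
    unfold IsStrong
    rwa [hR]
  -- All the points become one element of the direct limit, and this element realizes every `r n`.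
  refine ⟨Quot.mk _ ⟨_, e, hstrong, j 0 (x 0).1.pt⟩, fun n => ?_⟩
  rw [← (x n).2]
  refine (GaS.mk_eq_mk hAP).2 ⟨_, _, Embedding.refl L _, j n, isStrong_refl (hj n).mem, hj n, ?_, ?_⟩
  · exact he n
  · exact (jpt n).symm

end Compactness

end AbstractElementaryClass

/-! ### Cardinal arithmetic -/

section Cardinals

/-- The set is a union of at most `c` fibres, each of size at most `c`. -/
theorem mk_setOf_small_fiber_le {A B : Type u} (f : A → B) {c : Cardinal.{u}} (hc : ℵ₀ ≤ c)
    (hB : #B ≤ c) : #{a | #{a' | f a' = f a} ≤ c} ≤ c := by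
  have hsub : {a | #{a' | f a' = f a} ≤ c} ⊆
      ⋃ b : {b // #{a' | f a' = b} ≤ c}, {a' | f a' = b.1} :=
    fun a ha => Set.mem_iUnion.2 ⟨⟨f a, ha⟩, rfl⟩
  calc #{a | #{a' | f a' = f a} ≤ c}
      ≤ _ := mk_le_mk_of_subset hsub
    _ ≤ _ := mk_iUnion_le _
    _ ≤ c * c := mul_le_mul' ((mk_subtype_le _).trans hB) (ciSup_le' fun b => b.2)
    _ = c := mul_eq_self hc

theorem mk_iUnion_le_of_le {A : Type v} {I : Type u} (f : I → Set A) {c : Cardinal.{v}}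
    {d : Cardinal.{u}} (hI : #I ≤ d) (hd : lift.{v} d ≤ lift.{u} c) (hc : ℵ₀ ≤ c)
    (hf : ∀ i, #(f i) ≤ c) : #(⋃ i, f i) ≤ c := by
  rw [← lift_le.{u}]
  refine (mk_iUnion_le_lift f).trans ?_
  calc _ ≤ lift.{u} c * lift.{u} c :=
        mul_le_mul' ((lift_le.2 hI).trans hd) (ciSup_le' fun i => lift_le.2 (hf i))
    _ = lift.{u} c := mul_eq_self (aleph0_le_lift.2 hc)

/-- A set is covered by smaller subsets, one for each of its elements, which are cofinal among the
subsets of cardinality below its cofinality. -/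
theorem exists_cofinal_family (M : Type w) :
    ∃ A : M → Set M, (∀ b, #(A b) < #M) ∧
      ∀ B : Set M, #B < (#M).ord.cof → ∃ b, B ⊆ A b := by
  obtain ⟨e⟩ : Nonempty (M ≃ (#M).ord.ToType) := Cardinal.eq.1 (mk_ord_toType _).symm
  refine ⟨fun b => e ⁻¹' Set.Iio (e b), fun b => ?_, fun B hB => ?_⟩
  · rw [mk_preimage_equiv]
    simpa using mk_Iio_lt (e b)
  · have h : ¬ IsCofinal (e '' B) := fun h => by
      have := Order.cof_le h
      rw [Ordinal.cof_toType, mk_image_eq e.injective] at this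
      exact this.not_gt hB
    obtain ⟨x, hx⟩ := not_isCofinal_iff.1 h
    refine ⟨e.symm x, fun y hy => ?_⟩
    simpa using hx _ (Set.mem_image_of_mem e hy)

end Cardinals

/-! ### Small submodels and tameness -/

namespace AbstractElementaryClass

open FirstOrder.Language

variable {L : FirstOrder.Language.{u, v}} {K : AbstractElementaryClass.{u, v, w} L}

theorem aleph0_le_LS : ℵ₀ ≤ K.LS :=
  (csInf_mem K.exists_LS).1

variable {M : Type w} [L.Structure M]

theorem exists_strong_of_mk_le (hM : K.Mem M) {c : Cardinal.{w}} (hc : K.LS ≤ c) (A : Set M)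
    (hA : #A ≤ c) : ∃ S : L.Substructure M, A ⊆ S ∧ K.Strong S ∧ #S ≤ c := by
  obtain ⟨S, hAS, hS, hcard⟩ := (csInf_mem K.exists_LS).2 hM A
  refine ⟨S, hAS, hS, hcard.trans ?_⟩
  calc #A + K.LS ≤ c + c := add_le_add hA hc
    _ = c := add_eq_self (aleph0_le_LS.trans hc)

/-- Stability concerns models of an exact cardinality, so `A` is padded with a set of size `c`. -/
theorem exists_strong_of_mk_eq (hM : K.Mem M) {c : Cardinal.{w}} (hc : K.LS ≤ c) (hcM : c ≤ #M)
    (A : Set M) (hA : #A ≤ c) : ∃ S : L.Substructure M, A ⊆ S ∧ K.Strong S ∧ #S = c := by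
  obtain ⟨B, hB⟩ := le_mk_iff_exists_set.1 hcM
  obtain ⟨S, hAS, hS, hcard⟩ := exists_strong_of_mk_le hM hc (A ∪ B)
    ((mk_union_le A B).trans ((add_le_add hA hB.le).trans
      (add_eq_self (aleph0_le_LS.trans hc)).le))
  exact ⟨S, Set.subset_union_left.trans hAS, hS, hcard.antisymm
    (hB.symm.trans_le (mk_le_mk_of_subset (Set.subset_union_right.trans hAS)))⟩

/-- Restriction of a Galois type to a strong submodel. -/
abbrev GaS.res {S : L.Substructure M} (hS : K.Strong S) (p : K.GaS M) : K.GaS S :=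
  GaS.restrict K S.subtype (K.isStrong_subtype hS) p

theorem GaS.restrict_inclusion_res {S T : L.Substructure M} (hS : K.Strong S) (hT : K.Strong T)
    (h : S ≤ T) (p : K.GaS M) :
    GaS.restrict K (Substructure.inclusion h) (isStrong_inclusion hS hT h) (GaS.res hT p) =
      GaS.res hS p :=
  GaS.restrict_restrict _ _ _ _ p

theorem GaS.res_eq_of_le {S T : L.Substructure M} (hS : K.Strong S) (hT : K.Strong T)
    (h : S ≤ T) {p q : K.GaS M} (e : GaS.res hT p = GaS.res hT q) :
    GaS.res hS p = GaS.res hS q := by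
  rw [← GaS.restrict_inclusion_res hS hT h, e, GaS.restrict_inclusion_res]

/-- Distinct types in a small family are already distinct over a small strong submodel. -/
theorem exists_strong_res_injective {χ lam : Cardinal.{w}} (hχ : K.LS ≤ χ) (htame : K.Tame χ)
    (hlam : χ ≤ lam) (hM : K.Mem M) {I : Type w} (hI : #I ≤ lam) (p : I → K.GaS M)
    (hp : Function.Injective p) :
    ∃ (T : L.Substructure M) (hT : K.Strong T), #T ≤ lam ∧
      Function.Injective fun i => GaS.res hT (p i) := by
  have hinf : ℵ₀ ≤ lam := aleph0_le_LS.trans (hχ.trans hlam)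
  have key : ∀ x : {x : I × I // x.1 ≠ x.2}, ∃ (S : L.Substructure M) (hS : K.Strong S), #S ≤ χ ∧
      GaS.res hS (p x.1.1) ≠ GaS.res hS (p x.1.2) :=
    fun x => htame M hM _ _ fun h => x.2 (hp h)
  choose S hS hcard hne using key
  -- Only `lam * lam = lam` pairs have to be separated, each by a model of size at most `χ ≤ lam`.
  obtain ⟨T, hST, hT, hTcard⟩ := exists_strong_of_mk_le hM (hχ.trans hlam)
    (⋃ x, (S x : Set M)) (mk_iUnion_le_of_le (d := lam) _
      ((mk_subtype_le _).trans (by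
        rw [mk_prod, lift_id]
        exact (mul_le_mul' hI hI).trans (mul_eq_self hinf).le)) le_rfl hinf
      fun x => (hcard x).trans hlam)
  refine ⟨T, hT, hTcard, fun i j hij => ?_⟩
  by_contra h
  exact hne ⟨(i, j), h⟩ (GaS.res_eq_of_le _ hT
    ((Set.subset_iUnion (fun x => (S x : Set M)) _).trans hST) hij)

/-! ### The tree of types -/

/-- The sequence of the first `n` values of `f`, the last one first. -/
def branch {I : Type w} (f : ℕ → I) : ℕ → List I
  | 0 => []
  | n + 1 => f n :: branch f n

theorem branch_congr {I : Type w} {f g : ℕ → I} {n : ℕ} (h : ∀ m < n, f m = g m) :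
    branch f n = branch g n := by
  induction n with
  | zero => rfl
  | succ n ih => rw [branch, branch, h n n.lt_succ_self, ih fun m hm => h m (hm.trans n.lt_succ_self)]

/-- A set of types which splits `lam` times over every small strong submodel yields a
`lam`-branching tree of types, hence `lam ^ ℵ₀` types over a model of cardinality `lam`. -/
theorem exists_many_types_of_splitting (hAP : K.AP) {χ lam : Cardinal.{w}} (hχ : K.LS ≤ χ)
    (htame : K.Tame χ) (hlam : χ ≤ lam) (hM : K.Mem M) (hlamM : lam ≤ #M) (G : Set (K.GaS M))
    (hne : G.Nonempty)
    (hG : ∀ p ∈ G, ∀ (S : L.Substructure M) (hS : K.Strong S), #S ≤ lam →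
      lift.{max u v (w + 1)} lam ≤
        lift.{w} #{p' | p' ∈ G ∧ GaS.res hS p' = GaS.res hS p}) :
    ∃ (N : L.Substructure M), K.Strong N ∧ #N = lam ∧
      lift.{max u v (w + 1)} (lam ^ ℵ₀) ≤ lift.{w} #(K.GaS N) := by
  have hLS : K.LS ≤ lam := hχ.trans hlam
  have hinf : ℵ₀ ≤ lam := aleph0_le_LS.trans hLS
  induction lam using Cardinal.inductionOn with
  | mk I =>
  have : Infinite I := infinite_iff.2 hinf
  -- Each stage labels all finite sequences; only those of length `n` matter at stage `n`.
  let State := {S : L.Substructure M // K.Strong S ∧ #S = #I} × (List I → G)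
  have step : ∀ x : State, ∃ y : State, x.1.1 ≤ y.1.1 ∧
      (∀ s i, GaS.res x.1.2.1 (y.2 (i :: s)).1 = GaS.res x.1.2.1 (x.2 s).1) ∧
      ∀ s i j, GaS.res y.1.2.1 (y.2 (i :: s)).1 = GaS.res y.1.2.1 (y.2 (j :: s)).1 → i = j := by
    rintro ⟨⟨S, hS, hcard⟩, p⟩
    have h1 : ∀ s, Nonempty (I ↪ {p' | p' ∈ G ∧ GaS.res hS p' = GaS.res hS (p s).1}) :=
      fun s => lift_mk_le'.1 (hG _ (p s).2 S hS hcard.le)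
    let q : ∀ s, I ↪ {p' | p' ∈ G ∧ GaS.res hS p' = GaS.res hS (p s).1} := fun s => (h1 s).some
    choose T hT hTcard hTinj using fun s => exists_strong_res_injective hχ htame hlam hM le_rfl
      (fun i => (q s i).1) (Subtype.val_injective.comp (q s).injective)
    obtain ⟨N, hN, hNs, hNcard⟩ := exists_strong_of_mk_eq hM hLS hlamM
      ((S : Set M) ∪ ⋃ s, (T s : Set M)) ((mk_union_le _ _).trans ((add_le_add hcard.le
        (mk_iUnion_le_of_le _ (mk_list_eq_mk I).le le_rfl hinf hTcard)).trans
          (add_eq_self hinf).le))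
    -- The value at `[]` is a dummy: `branch f (n + 1)` is never empty.
    refine ⟨⟨⟨N, hNs, hNcard⟩, fun s => match s with
      | [] => p []
      | i :: s => ⟨(q s i).1, (q s i).2.1⟩⟩, Set.subset_union_left.trans hN,
      fun s i => (q s i).2.2, fun s i j hij => hTinj s ?_⟩
    exact GaS.res_eq_of_le _ hNs (((Set.subset_iUnion (fun s => (T s : Set M)) s).trans
      Set.subset_union_right).trans hN) hij
  choose next hle hres hinj using step
  obtain ⟨S₀, -, hS₀, hcard₀⟩ := exists_strong_of_mk_eq hM hLS hlamM ∅ (by simp)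
  let x : ℕ → State := fun n =>
    Nat.rec (⟨⟨S₀, hS₀, hcard₀⟩, fun _ => ⟨hne.some, hne.some_mem⟩⟩ : State) (fun _ => next) n
  let T : ℕ →o L.Substructure M :=
    ⟨fun n => (x n).1.1, monotone_nat_of_le_succ fun n => hle (x n)⟩
  have hT : ∀ n, K.Strong (T n) := fun n => (x n).1.2.1
  have hTcard : ∀ n, #(T n) = #I := fun n => (x n).1.2.2
  have hlim : ∀ f : ℕ → I, ∃ t : K.GaS (⨆ n, T n : L.Substructure M), ∀ n,
      GaS.restrict K (Substructure.inclusion (le_iSup T n))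
        (isStrong_inclusion (hT n) (strong_iSup T hT) _) t =
      GaS.res (hT n) ((x n).2 (branch f n)).1 := fun f =>
    GaS.exists_restrict_eq_of_seq hAP T hT
      (fun n => GaS.res (hT n) ((x n).2 (branch f n)).1) fun n =>
        (GaS.restrict_inclusion_res _ _ _ _).trans (hres (x n) (branch f n) (f n))
  choose t ht using hlim
  refine ⟨⨆ n, T n, strong_iSup T hT, le_antisymm ?_ ?_, ?_⟩
  · change #((⨆ n, T n : L.Substructure M) : Set M) ≤ #I
    rw [coe_iSup_orderHom]
    exact mk_iUnion_le_of_le _ (d := ℵ₀) mk_nat.le (by simp) hinf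
      fun n => (hTcard n).le
  · exact (hTcard 0).symm.trans_le (mk_le_mk_of_subset (le_iSup T 0))
  · have hcard : lift.{max u v (w + 1)} (#I ^ ℵ₀) = lift.{max u v (w + 1)} #(ℕ → I) := by
      simp
    rw [hcard]
    refine lift_mk_le'.2 ⟨t, fun f g hfg => funext fun n => ?_⟩
    induction n using Nat.strong_induction_on with
    | _ n ih =>
    -- As `f` and `g` agree below `n`, the two nodes at level `n + 1` are siblings, which `hinj`
    -- separates.
    have h := (ht f (n + 1)).symm.trans ((congrArg _ hfg).trans (ht g (n + 1)))
    rw [branch, branch, branch_congr ih] at h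
    exact hinj (x n) _ _ _ h

/-! ### The splitting set -/

/-- If few types exist over each member of a family of strong submodels that is cofinal for small
submodels, but many over `M`, then some set of types splits over every small strong submodel. -/
theorem exists_splitting_set {lam : Cardinal.{w}} (hinf : ℵ₀ ≤ lam) (hlamM : lam ≤ #M)
    (T : M → L.Substructure M) (hT : ∀ b, K.Strong (T b))
    (hTcard : ∀ b, #(K.GaS (T b)) ≤ lift.{max u v (w + 1)} #M)
    (hcof : ∀ S : L.Substructure M, #S ≤ lam → ∃ b, S ≤ T b)
    (hmany : lift.{max u v (w + 1)} #M < #(K.GaS M)) :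
    ∃ G : Set (K.GaS M), G.Nonempty ∧
      ∀ p ∈ G, ∀ (S : L.Substructure M) (hS : K.Strong S), #S ≤ lam →
        lift.{max u v (w + 1)} lam ≤
          lift.{w} #{p' | p' ∈ G ∧ GaS.res hS p' = GaS.res hS p} := by
  have hm : ℵ₀ ≤ lift.{max u v (w + 1)} #M := aleph0_le_lift.2 (hinf.trans hlamM)
  let B : Set (K.GaS M) := ⋃ b, {p | #{p' | GaS.res (hT b) p' = GaS.res (hT b) p} ≤
    lift.{max u v (w + 1)} #M}
  have hB : #B ≤ lift.{max u v (w + 1)} #M :=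
    mk_iUnion_le_of_le _ le_rfl (by simp) hm
      fun b => mk_setOf_small_fiber_le (GaS.res (hT b)) hm (hTcard b)
  refine ⟨Bᶜ, ?_, fun p hp S hS hcard => ?_⟩
  · rw [Set.nonempty_compl]
    intro h
    rw [h, mk_univ] at hB
    exact hB.not_gt hmany
  · obtain ⟨b, hb⟩ := hcof S hcard
    have hbig : lift.{max u v (w + 1)} #M <
        #{p' | GaS.res (hT b) p' = GaS.res (hT b) p} := by
      by_contra h
      exact hp (Set.mem_iUnion.2 ⟨b, not_lt.1 h⟩)
    have hsub : {p' | GaS.res (hT b) p' = GaS.res (hT b) p} ⊆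
        {p' | p' ∈ Bᶜ ∧ GaS.res hS p' = GaS.res hS p} ∪ B := fun p' hp' => by
      by_cases h : p' ∈ B
      · exact Or.inr h
      · exact Or.inl ⟨h, GaS.res_eq_of_le hS (hT b) hb hp'⟩
    have hlt : lift.{max u v (w + 1)} #M < #{p' | p' ∈ Bᶜ ∧ GaS.res hS p' = GaS.res hS p} := by
      by_contra h
      refine hbig.not_ge ((mk_le_mk_of_subset hsub).trans ((mk_union_le _ _).trans ?_))
      exact (add_le_add (not_lt.1 h) hB).trans (add_eq_self hm).le
    calc lift.{max u v (w + 1)} lam ≤ lift.{max u v (w + 1)} #M := lift_le.2 hlamM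
      _ ≤ _ := hlt.le
      _ = _ := (lift_id'.{w, max u v (w + 1)} _).symm

theorem lift_mk_le_mk_gaS (hAP : K.AP) (hM : K.Mem M) :
    lift.{max u v (w + 1)} #M ≤ #(K.GaS M) := by
  have h := lift_mk_le'.2 ⟨⟨GaS.ofElem hM, GaS.ofElem_injective hAP hM⟩⟩
  rwa [lift_id'.{w, max u v (w + 1)}] at h

end AbstractElementaryClass

/-! ### The main theorem -/

theorem theorem5p10 {L : FirstOrder.Language.{u, v}} (K : AbstractElementaryClass.{u, v, w} L)
    (hJEP : K.JEP) (hAP : K.AP)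
    (χ lam : Cardinal.{w}) (hχ : K.LS ≤ χ) (htame : K.Tame χ)
    (hlam : χ ≤ lam) (hstable : K.Stable lam) (hpow : lam < lam ^ ℵ₀)
    (μ : Cardinal.{w}) (hμ : lam < μ.ord.cof)
    (κ : Cardinal.{w}) (hκ : κ < μ)
    (S : Set Cardinal.{w}) (hS : S ⊆ Set.Ico κ μ)
    (hcofinal : ∀ ν ∈ Set.Ico κ μ, ∃ σ ∈ S, ν ≤ σ)
    (hSstable : ∀ σ ∈ S, K.Stable σ) :
    K.Stable μ := by
  intro M _ hM hMμ
  have hLS : K.LS ≤ lam := hχ.trans hlam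
  have hinf : ℵ₀ ≤ lam := AbstractElementaryClass.aleph0_le_LS.trans hLS
  have hlamμ : lam < μ := hμ.trans_le (Ordinal.cof_ord_le μ)
  subst hMμ
  refine le_antisymm ?_ (AbstractElementaryClass.lift_mk_le_mk_gaS hAP hM)
  by_contra! hmany
  obtain ⟨A, hA, hAcof⟩ := exists_cofinal_family M
  have hsmall : ∀ b, ∃ T : L.Substructure M, A b ⊆ T ∧ K.Strong T ∧
      #(K.GaS T) ≤ lift.{max u v (w + 1)} #M := by
    intro b
    -- The size `σ` must accommodate `A b` and be at least `LS`; joining `κ` puts the bound in the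
    -- interval where `S` is cofinal.
    obtain ⟨σ, hσ, hle⟩ := hcofinal (max κ (max #(A b) lam))
      ⟨le_max_left _ _, max_lt hκ (max_lt (hA b) hlamμ)⟩
    have hσμ := (hS hσ).2
    obtain ⟨-, hAσ, hlamσ⟩ := (max_le_iff.1 hle).imp id max_le_iff.1
    obtain ⟨T, hAT, hT, hTσ⟩ := AbstractElementaryClass.exists_strong_of_mk_eq hM
      (hLS.trans hlamσ) hσμ.le (A b) hAσ
    exact ⟨T, hAT, hT, (hSstable σ hσ T (K.mem_left hT) hTσ).trans_le (lift_le.2 hσμ.le)⟩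
  choose T hAT hT hTcard using hsmall
  obtain ⟨G, hne, hG⟩ := AbstractElementaryClass.exists_splitting_set hinf hlamμ.le T hT hTcard
    (fun N hN => (hAcof N (hN.trans_lt hμ)).imp fun b hb => hb.trans (hAT b)) hmany
  obtain ⟨N, hN, hNcard, hNtypes⟩ := AbstractElementaryClass.exists_many_types_of_splitting hAP hχ
    htame hlam hM hlamμ.le G hne hG
  rw [hstable N (K.mem_left hN) hNcard] at hNtypes
  simp only [lift_lift] at hNtypes
  exact (lift_le.1 hNtypes).not_gt hpow
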